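/- Let $M$ be an $n$-dimensional affine manifold, that is, a Hausdorff topological manifold without boundary with an atlas whose changes of coordinates are locally restrictions of affine transformations of $\mathbb{R}^n$. Suppose that $M$ is compact and connected, let $x_0\in M$, let $h_M:\pi_1(M,x_0)\to \mathrm{Aff}(\mathbb{R}^n)$ be its holonomy representation (the representation for which the developing map $D_M:\hat M\to\mathbb{R}^n$ of the universal cover $\hat M$ of $M$ satisfies $D_M(\gamma\cdot\hat x)=h_M(\gamma)(D_M(\hat x))$), and let $L(h_M):\pi_1(M,x_0)\to GL(\mathbb{R}^n)$ be its linear part. Suppose that $M$ is endowed with a linear foliation of codimension $1$, that is, a vector subspace $U\subset\mathbb{R}^n$ of codimension $1$ such that $L(h_M)(\gamma)(U)=U$ for every $\gamma\in\pi_1(M,x_0)$ (the foliation of $M$ is the one whose pullback to $\hat M$ is the pullback by $D_M$ of the foliation of $\mathbb{R}^n$ by the affine subspaces parallel to $U$). Then there exists a finite cover $M'$ of $M$, that is, a connected space $M'$ with a surjective covering map $M'\to M$ with finite fibres, such that the first singular cohomology group satisfies $H^1(M',\mathbb{R})\neq 0$. -/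

import Mathlib

open Set Filter Topology

universe u

noncomputable section

namespace AffineManifold

/-- The model space `ℝⁿ`. -/
abbrev Model (n : ℕ) : Type := EuclideanSpace ℝ (Fin n)

/-- The group `Aff(ℝⁿ)` of invertible affine transformations of `ℝⁿ`. -/
abbrev Aff (n : ℕ) : Type := Model n ≃ᵃ[ℝ] Model n

/-- The group `Aff(ℝⁿ)` is given the discrete topology here. -/
instance (n : ℕ) : TopologicalSpace (Aff n) := ⊥

instance (n : ℕ) : DiscreteTopology (Aff n) := ⟨rfl⟩

theorem aff_continuous {n : ℕ} (A : Aff n) : Continuous A :=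
  A.toAffineMap.continuous_of_finiteDimensional

/-- Two affine transformations that agree near a point are equal. -/
theorem aff_eq_of_eventuallyEq {n : ℕ} {A B : Aff n} {x : Model n}
    (h : (A : Model n → Model n) =ᶠ[𝓝 x] B) : A = B := by
  obtain ⟨U, hU, hUo, hxU⟩ := eventually_nhds_iff.mp h
  have hs : affineSpan ℝ U = ⊤ := hUo.affineSpan_eq_top ⟨x, hxU⟩
  have : A.toAffineMap = B.toAffineMap := AffineMap.ext_on hs fun y hy => hU y hy
  ext1 y
  exact congrArg (fun f : Model n →ᵃ[ℝ] Model n => f y) this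

/-- The pregroupoid of maps that are, near every point, restrictions of affine
transformations of `ℝⁿ`. -/
def affinePregroupoid (n : ℕ) : Pregroupoid (Model n) where
  property f s := ∀ x ∈ s, ∃ A : Aff n, f =ᶠ[𝓝 x] A
  comp := by
    intro f g s t hf hg hs ht hst x hx
    obtain ⟨A, hA⟩ := hf x hx.1
    obtain ⟨B, hB⟩ := hg (f x) hx.2
    refine ⟨A.trans B, ?_⟩
    have hfx : f x = A x := hA.self_of_nhds
    rw [hfx] at hB
    have hB' := (aff_continuous A).continuousAt.tendsto.eventually hB
    filter_upwards [hA, hB'] with y hy hy'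
    simp only [Function.comp_apply, AffineEquiv.trans_apply, hy]
    exact hy'
  id_mem := fun x _ => ⟨AffineEquiv.refl ℝ _, Eventually.of_forall fun _ => rfl⟩
  locality := by
    intro f s _ h x hx
    obtain ⟨v, _, hxv, hp⟩ := h x hx
    exact hp x ⟨hx, hxv⟩
  congr := by
    intro f g s hs hfg h x hx
    obtain ⟨A, hA⟩ := h x hx
    refine ⟨A, ?_⟩
    filter_upwards [hA, hs.mem_nhds hx] with y hy hys
    rw [hfg y hys, hy]

/-- The structure groupoid of local homeomorphisms of `ℝⁿ` that are locally affine. A space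
with an atlas whose changes of coordinates lie in this groupoid is an `n`-dimensional affine
manifold: the class `HasGroupoid M (affineGroupoid n)`. -/
def affineGroupoid (n : ℕ) : StructureGroupoid (Model n) :=
  (affinePregroupoid n).groupoid

section Holonomy

variable (n : ℕ) (M : Type u) [TopologicalSpace M]

/-- `IsTransition n M e e' x A`: near `x`, the chart `e'` is the chart `e` followed by `A`. -/
def IsTransition (e e' : OpenPartialHomeomorph M (Model n)) (x : M) (A : Aff n) : Prop :=
  (e' : M → Model n) =ᶠ[𝓝 x] fun y => A (e y)

variable {n M}

theorem IsTransition.unique {e e' : OpenPartialHomeomorph M (Model n)} {x : M} {A B : Aff n}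
    (hx : x ∈ e.source) (hA : IsTransition n M e e' x A) (hB : IsTransition n M e e' x B) :
    A = B := by
  apply aff_eq_of_eventuallyEq (x := e x)
  have h : ∀ᶠ y in 𝓝 x, A (e y) = B (e y) := by
    filter_upwards [hA, hB] with y h1 h2
    rw [← h1, ← h2]
  have h2 := (e.tendsto_symm hx).eventually h
  filter_upwards [h2, e.open_target.mem_nhds (e.map_source hx)] with z hz hzt
  rwa [e.right_inv hzt] at hz

theorem IsTransition.trans {e e' e'' : OpenPartialHomeomorph M (Model n)} {x : M} {A B : Aff n}
    (hA : IsTransition n M e e' x A) (hB : IsTransition n M e' e'' x B) :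
    IsTransition n M e e'' x (B * A) := by
  filter_upwards [hA, hB] with y h1 h2
  rw [h2, h1]
  rfl

open Classical in
/-- The affine transformation `A` with `e' = A ∘ e` near `x` (the identity if there is none). -/
def transition (e e' : OpenPartialHomeomorph M (Model n)) (x : M) : Aff n :=
  if h : ∃ A : Aff n, IsTransition n M e e' x A then h.choose else 1

theorem transition_eq {e e' : OpenPartialHomeomorph M (Model n)} {x : M} {A : Aff n}
    (hx : x ∈ e.source) (hA : IsTransition n M e e' x A) : transition e e' x = A := by
  have h : ∃ A : Aff n, IsTransition n M e e' x A := ⟨A, hA⟩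
  rw [transition, dif_pos h]
  exact IsTransition.unique hx h.choose_spec hA

variable [ChartedSpace (Model n) M]

theorem exists_isTransition [HasGroupoid M (affineGroupoid n)]
    {e e' : OpenPartialHomeomorph M (Model n)} (he : e ∈ atlas (Model n) M)
    (he' : e' ∈ atlas (Model n) M) {x : M} (hx : x ∈ e.source ∩ e'.source) :
    ∃ A : Aff n, IsTransition n M e e' x A := by
  have hc := (HasGroupoid.compatible (G := affineGroupoid n) he he')
  have h1 := (mem_groupoid_of_pregroupoid.mp hc).1 (e x) (by
    simp [e.map_source hx.1, e.left_inv hx.1, hx.2])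
  obtain ⟨A, hA⟩ := h1
  refine ⟨A, ?_⟩
  have := (e.continuousAt hx.1).tendsto.eventually hA
  filter_upwards [this, e.open_source.mem_nhds hx.1] with y hy hys
  simpa [e.left_inv hys] using hy

variable (n M)

/-- The flat bundle of germs of affine coordinate systems on the affine manifold `M`.

The pair `(x, A)` stands for the germ at `x` of the local affine coordinate system
`A ∘ chartAt x`. In a chart `e` the germ of `A ∘ e` has coordinate `A`; since `A` is taken from
the discrete group, the locally constant sections are exactly the local affine coordinate
systems, and moving along a path in the total space is continuation of an affine coordinate
system along a path of `M`. -/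
def germBundle [HasGroupoid M (affineGroupoid n)] :
    FiberBundleCore (atlas (Model n) M) M (Aff n) where
  baseSet e := e.1.source
  isOpen_baseSet e := e.1.open_source
  indexAt x := ⟨chartAt (Model n) x, chart_mem_atlas _ x⟩
  mem_baseSet_at x := mem_chart_source _ x
  coordChange e e' x A := A * (transition e.1 e'.1 x)⁻¹
  coordChange_self := by
    intro e x hx A
    have : transition e.1 e.1 x = 1 :=
      transition_eq hx (Eventually.of_forall fun _ => rfl)
    rw [this, inv_one, mul_one]
  continuousOn_coordChange := by
    rintro e e' ⟨x, A⟩ ⟨hx, -⟩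
    obtain ⟨B, hB⟩ := exists_isTransition e.2 e'.2 hx
    have hB' : ∀ᶠ y in 𝓝 x, IsTransition n M e.1 e'.1 y B := eventually_eventually_nhds.mpr hB
    apply ContinuousAt.continuousWithinAt
    have hev : ∀ᶠ p : M × Aff n in 𝓝 (x, A),
        (A * (transition e.1 e'.1 x)⁻¹ : Aff n) =
          (p.2 * (transition e.1 e'.1 p.1)⁻¹ : Aff n) := by
      have h2 : ∀ᶠ C : Aff n in 𝓝 A, C = A := by
        rw [nhds_discrete]; exact rfl
      have h1 := hB'.and (e.1.open_source.mem_nhds hx.1)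
      rw [nhds_prod_eq]
      filter_upwards [h1.prod_mk h2] with p hp
      rw [transition_eq hx.1 hB, transition_eq hp.1.2 hp.1.1, hp.2]
    exact (continuousAt_const (y := (A * (transition e.1 e'.1 x)⁻¹ :
      Aff n))).congr hev
  coordChange_comp := by
    rintro e e' e'' x ⟨⟨h1, h2⟩, h3⟩ A
    obtain ⟨B, hB⟩ := exists_isTransition e.2 e'.2 ⟨h1, h2⟩
    obtain ⟨C, hC⟩ := exists_isTransition e'.2 e''.2 ⟨h2, h3⟩
    rw [transition_eq h1 hB, transition_eq h2 hC, transition_eq h1 (hB.trans hC)]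
    have key : ∀ a : Aff n, a * B⁻¹ * C⁻¹ = a * (C * B)⁻¹ := fun a => by
      rw [mul_inv_rev, mul_assoc]
    exact key A

variable [HasGroupoid M (affineGroupoid n)]

/-- The total space of the bundle of germs of affine coordinate systems. -/
abbrev AffineGerm : Type u := (germBundle n M).TotalSpace

theorem isCoveringMap_germ : IsCoveringMap (germBundle n M).proj :=
  FiberBundle.isCoveringMap

variable {n M}

/-- The affine transformation `A` of the germ at `x` of `A ∘ chartAt x`. -/
def AffineGerm.toAff (p : AffineGerm n M) : Aff n := p.2

/-- The germ at `x` of `A ∘ chartAt x`. -/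
def AffineGerm.mk (x : M) (A : Aff n) : AffineGerm n M := ⟨x, A⟩

/-- Value of a germ of affine coordinate system at its base point. -/
def AffineGerm.eval (p : AffineGerm n M) : Model n :=
  p.toAff (chartAt (Model n) p.1 p.1)

/-- The action of `Aff(ℝⁿ)` on germs of affine coordinate systems by composition on the left. -/
def AffineGerm.act (A : Aff n) (p : AffineGerm n M) : AffineGerm n M :=
  AffineGerm.mk p.1 (A * p.toAff)

theorem AffineGerm.act_continuous (A : Aff n) :
    Continuous (AffineGerm.act (M := M) A) := by
  rw [continuous_iff_continuousAt]
  intro p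
  let Z := germBundle n M
  let e := Z.localTriv (Z.indexAt p.1)
  have hp : p.1 ∈ Z.baseSet (Z.indexAt p.1) := Z.mem_baseSet_at p.1
  refine e.continuousAt_of_comp_left (f := AffineGerm.act A) ?_ hp ?_
  · exact (Z.continuous_proj).continuousAt
  · have h : e ∘ AffineGerm.act A =
        (fun q : M × Aff n => (q.1, A * q.2)) ∘ e := by
      funext q
      refine Prod.ext rfl ?_
      exact mul_assoc (G := Aff n) A q.toAff _
    rw [h]
    refine ContinuousAt.comp ?_ (e.continuousAt ?_)
    · exact (continuous_fst.prodMk (continuous_of_discreteTopology.comp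
        continuous_snd)).continuousAt
    · exact (e.mem_source).2 hp

/-- Continuation along paths commutes with the action of `Aff(ℝⁿ)`. -/
theorem monodromy_act {x y : M} (c : Path.Homotopic.Quotient x y) (A : Aff n)
    (p : (germBundle n M).proj ⁻¹' {x}) :
    ((isCoveringMap_germ n M).monodromy c ⟨AffineGerm.act A p.1, p.2⟩).1 =
      AffineGerm.act A ((isCoveringMap_germ n M).monodromy c p).1 := by
  obtain ⟨c⟩ := c
  have cov := isCoveringMap_germ n M
  have h0 : c 0 = (germBundle n M).proj p.1 := c.source.trans p.2.symm
  have h1 : c 0 = (germBundle n M).proj (AffineGerm.act A p.1) := h0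
  have key : AffineGerm.act A ∘ (cov.liftPath c p.1 h0) =
      cov.liftPath c (AffineGerm.act A p.1) h1 := by
    refine (cov.eq_liftPath_iff h1).2 ⟨(AffineGerm.act_continuous A).comp (ContinuousMap.continuous _), ?_, ?_⟩
    · exact cov.liftPath_lifts c p.1 h0
    · simp only [Function.comp_apply, cov.liftPath_zero]
  exact (congrFun key 1).symm

/-- The germ at `x` obtained by continuing the chart at `x₀` along a homotopy class of paths
from `x₀` to `x`. -/
def continuation (x₀ : M) {x : M} (c : Path.Homotopic.Quotient x₀ x) : AffineGerm n M :=
  ((isCoveringMap_germ n M).monodromy c ⟨AffineGerm.mk x₀ 1, rfl⟩).1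

/-- The developing map. The points of the universal cover of `M` (with base point `x₀`) are the
homotopy classes of paths starting at `x₀`; the developing map sends the class of `c` to the
value at the end point of `c` of the chart at `x₀` continued along `c`. -/
def developingMap (x₀ : M) {x : M} (c : Path.Homotopic.Quotient x₀ x) : Model n :=
  (continuation (n := n) x₀ c).eval

theorem continuation_loop (x₀ : M) (g : Path.Homotopic.Quotient x₀ x₀) :
    continuation (n := n) x₀ g =
      AffineGerm.act (continuation (n := n) x₀ g).toAff (AffineGerm.mk x₀ 1) := by
  have h : (continuation (n := n) x₀ g).1 = x₀ :=
    ((isCoveringMap_germ n M).monodromy g ⟨AffineGerm.mk x₀ 1, rfl⟩).2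
  revert h
  generalize continuation (n := n) x₀ g = p
  intro h
  obtain ⟨y, A⟩ := p
  obtain rfl : y = x₀ := h
  exact congrArg (Bundle.TotalSpace.mk y) (mul_one (M := Aff n) A).symm

theorem continuation_trans (x₀ : M) {x : M} (g : Path.Homotopic.Quotient x₀ x₀)
    (c : Path.Homotopic.Quotient x₀ x) :
    continuation (n := n) x₀ (g.trans c) =
      AffineGerm.act (continuation (n := n) x₀ g).toAff (continuation x₀ c) := by
  have cov := isCoveringMap_germ n M
  have h := monodromy_act c (continuation (n := n) x₀ g).toAff
    (p := ⟨AffineGerm.mk x₀ 1, rfl⟩)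
  refine Eq.trans ?_ h
  rw [continuation, cov.monodromy_trans_apply]
  exact congrArg (fun q => (cov.monodromy c q).1) (Subtype.ext (continuation_loop x₀ g))

/-- The holonomy representation `h : π₁(M, x₀) → Aff(ℝⁿ)`. The class `γ` acts on the universal
cover by `[c] ↦ [γ⁻¹ · c]` (a left action, since in Mathlib the product `p * q` of the
fundamental group is `q` followed by `p`), and `h γ` is the affine transformation by which the
developing map changes, see `developingMap_deck`. -/
def holonomy (x₀ : M) : FundamentalGroup M x₀ →* Aff n where
  toFun γ := (continuation (n := n) x₀ (FundamentalGroup.toPath γ⁻¹)).toAff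
  map_one' := by
    have cov := isCoveringMap_germ n M
    rw [inv_one]
    exact congrArg (fun f => (AffineGerm.toAff (f ⟨AffineGerm.mk x₀ 1, rfl⟩).1))
      (cov.monodromy_refl (x := x₀))
  map_mul' p q := by
    have h : FundamentalGroup.toPath (p * q)⁻¹ =
        (FundamentalGroup.toPath p⁻¹).trans (FundamentalGroup.toPath q⁻¹) := by
      rw [mul_inv_rev]; rfl
    rw [h, continuation_trans]
    rfl

/-- Equivariance of the developing map: `D (γ · x̂) = h(γ) (D x̂)`. -/
theorem developingMap_deck (x₀ : M) (γ : FundamentalGroup M x₀) {x : M}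
    (c : Path.Homotopic.Quotient x₀ x) :
    developingMap (n := n) x₀ ((FundamentalGroup.toPath γ⁻¹).trans c) =
      holonomy x₀ γ (developingMap x₀ c) := by
  rw [developingMap, continuation_trans]
  rfl

/-- The linear holonomy representation `L(h) : π₁(M, x₀) → GL(ℝⁿ)`. -/
def linearHolonomy (x₀ : M) : FundamentalGroup M x₀ →* (Model n ≃ₗ[ℝ] Model n) :=
  AffineEquiv.linearHom.comp (holonomy x₀)

end Holonomy

/-- A linear foliation of the affine manifold `M`: it is given by a vector subspace `U` of `ℝⁿ`
which is invariant under the linear holonomy. Its leaves on the universal cover are the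
components of the preimages of the translates of `U` under the developing map. -/
structure LinearFoliation (n : ℕ) (M : Type u) [TopologicalSpace M] [ChartedSpace (Model n) M]
    [HasGroupoid M (affineGroupoid n)] (x₀ : M) where
  /-- The vector subspace `U` of `ℝⁿ` to which the leaves are parallel. -/
  direction : Submodule ℝ (Model n)
  /-- `L(h)(γ)(U) = U` for every `γ` in the fundamental group. -/
  map_linearHolonomy : ∀ γ : FundamentalGroup M x₀,
    direction.map (linearHolonomy (n := n) x₀ γ : Model n →ₗ[ℝ] Model n) = direction

/-- The codimension of a linear foliation. -/
def LinearFoliation.codim {n : ℕ} {M : Type u} [TopologicalSpace M] [ChartedSpace (Model n) M]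
    [HasGroupoid M (affineGroupoid n)] {x₀ : M} (F : LinearFoliation n M x₀) : ℕ :=
  Module.finrank ℝ (Model n ⧸ F.direction)

/-- Singular `k`-simplices of `X`. -/
abbrev SingularSimplex (X : Type u) [TopologicalSpace X] (k : ℕ) : Type u :=
  C(stdSimplex ℝ (Fin (k + 1)), X)

/-- The `i`-th face of a singular `(k+1)`-simplex. -/
def SingularSimplex.face {X : Type u} [TopologicalSpace X] {k : ℕ} (i : Fin (k + 2))
    (s : SingularSimplex X (k + 1)) : SingularSimplex X k :=
  s.comp ⟨stdSimplex.map i.succAbove, stdSimplex.continuous_map i.succAbove⟩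

/-- The singular coboundary `Cᵏ(X, ℝ) → Cᵏ⁺¹(X, ℝ)`, where the real vector space `Cᵏ(X, ℝ)`
consists of all real functions on the set of singular `k`-simplices. -/
def coboundary (X : Type u) [TopologicalSpace X] (k : ℕ) :
    (SingularSimplex X k → ℝ) →ₗ[ℝ] (SingularSimplex X (k + 1) → ℝ) where
  toFun f s := ∑ i : Fin (k + 2), (-1 : ℝ) ^ (i : ℕ) * f (s.face i)
  map_add' f g := by
    funext s
    simp [mul_add, Finset.sum_add_distrib]
  map_smul' a f := by
    funext s
    simp only [Pi.smul_apply, smul_eq_mul, RingHom.id_apply, Finset.mul_sum]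
    exact Finset.sum_congr rfl fun i _ => by ring

/-- The first singular cohomology `H¹(X, ℝ)`: cocycles modulo coboundaries. -/
abbrev H1 (X : Type u) [TopologicalSpace X] : Type u :=
  LinearMap.ker (coboundary X 1) ⧸
    (LinearMap.range (coboundary X 0)).submoduleOf (LinearMap.ker (coboundary X 1))

end AffineManifold

end

noncomputable section

namespace AffineManifold

/-! ### First cohomology, path-additive functions and the fundamental group -/

section Cohomology

variable {X : Type u} [TopologicalSpace X]

/-! If `H1 M` is nonzero, `M` covers itself. Otherwise let `f` be a linear form with kernel `U`. The
linear holonomy multiplies `f` by a character `χ` with values in the nonzero reals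
(`LinearFoliation.exists_character`), and `log |χ|` is a homomorphism to `ℝ`, hence zero
(`hom_fundamentalGroup_eq_zero`). So `χ` takes only the values `1` and `-1`.

The cover is the space of all continuations of the covector `f` from `x₀`, a path component of the
flat cotangent bundle with discrete fibres. As `f` has at most two images under holonomy, the fibres
are finite (`finite_continued_inter_fiber`), so this component is compact and covers `M`
(`IsCoveringMap.isCoveringMap_of_isClopen`).

On this cover `f` becomes a single-valued parallel 1-form, whose integral along a path is
`increment`. It is not exact (`nontrivial_H1_continued`): a primitive would lift, on germs of affine
coordinates, to `f` composed with the developing map plus a constant. That function is continuous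
and open, so the primitive would have a nonempty compact open image in `ℝ`, which is impossible.

Singular cochains are arbitrary functions, so 1-forms are replaced throughout by additive functions
of homotopy classes of paths (`exists_primitive`), and continuity of a primitive has to be proved.
-/

theorem simplyConnectedSpace_stdSimplex (k : ℕ) :
    SimplyConnectedSpace (stdSimplex ℝ (Fin (k + 1))) := by
  have := (convex_stdSimplex ℝ (Fin (k + 1))).contractibleSpace
    ⟨_, single_mem_stdSimplex ℝ (0 : Fin (k + 1))⟩
  infer_instance

/-- The singular `1`-simplex given by a continuous map on the unit interval. -/
def simplexOfPath (c : C(unitInterval, X)) : SingularSimplex X 1 :=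
  c.comp ⟨stdSimplexHomeomorphUnitInterval, stdSimplexHomeomorphUnitInterval.continuous⟩

/-- The continuous map on the unit interval given by a singular `1`-simplex. -/
def pathOfSimplex (s : SingularSimplex X 1) : C(unitInterval, X) :=
  s.comp ⟨stdSimplexHomeomorphUnitInterval.symm, stdSimplexHomeomorphUnitInterval.symm.continuous⟩

theorem pathOfSimplex_simplexOfPath (c : C(unitInterval, X)) :
    pathOfSimplex (simplexOfPath c) = c := by
  ext t
  simp [pathOfSimplex, simplexOfPath]

theorem stdSimplexHomeomorphUnitInterval_symm_zero :
    stdSimplexHomeomorphUnitInterval.symm 0 = stdSimplex.vertex (S := ℝ) (0 : Fin 2) := by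
  rw [Homeomorph.symm_apply_eq]
  exact stdSimplexHomeomorphUnitInterval_zero.symm

theorem stdSimplexHomeomorphUnitInterval_symm_one :
    stdSimplexHomeomorphUnitInterval.symm 1 = stdSimplex.vertex (S := ℝ) (1 : Fin 2) := by
  rw [Homeomorph.symm_apply_eq]
  exact stdSimplexHomeomorphUnitInterval_one.symm

/-- The `i`-th edge of the standard `2`-simplex, as a path between two vertices. -/
def edgePath (i : Fin 3) :
    Path (stdSimplex.vertex (S := ℝ) (i.succAbove 0)) (stdSimplex.vertex (i.succAbove 1)) where
  toContinuousMap := pathOfSimplex ⟨stdSimplex.map i.succAbove, stdSimplex.continuous_map _⟩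
  source' := by
    simp [pathOfSimplex, stdSimplexHomeomorphUnitInterval_symm_zero, stdSimplex.map_vertex]
  target' := by
    simp [pathOfSimplex, stdSimplexHomeomorphUnitInterval_symm_one, stdSimplex.map_vertex]

/-- If `H¹(X, ℝ) = 0`, every additive function on homotopy classes of paths is the difference of
the values of a function at the end points. -/
theorem exists_primitive (hX : ¬ Nontrivial (H1 X))
    (Φ : ∀ x y : X, Path.Homotopic.Quotient x y → ℝ)
    (hΦ : ∀ x y z (c : Path.Homotopic.Quotient x y) (d : Path.Homotopic.Quotient y z),
      Φ x z (c.trans d) = Φ x y c + Φ y z d) :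
    ∃ h : X → ℝ, ∀ x y c, Φ x y c = h y - h x := by
  -- Forgetting the end points in the type allows equal maps to be rewritten without transport.
  let Ψ : C(unitInterval, X) → ℝ := fun c => Φ (c 0) (c 1) (.mk ⟨c, rfl, rfl⟩)
  have hΨ : ∀ {x y : X} (c : Path x y), Ψ c.toContinuousMap = Φ x y (.mk c) := by
    rintro x y ⟨c, rfl, rfl⟩
    rfl
  let φ : SingularSimplex X 1 → ℝ := fun s => Ψ (pathOfSimplex s)
  have hφ : coboundary X 1 φ = 0 := by
    funext s
    have hface : ∀ i : Fin 3, φ (s.face i) =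
        Φ _ _ ((Path.Homotopic.Quotient.mk (edgePath i)).map s) := fun i => by
      rw [← Path.Homotopic.Quotient.mk_map, ← hΨ]
      rfl
    -- In the simply connected triangle, edge `2` (from `0` to `1`) followed by edge `0` (from `1`
    -- to `2`) is homotopic to edge `1`. Additivity of `Φ` then gives the cocycle identity.
    have := simplyConnectedSpace_stdSimplex 2
    have h := Subsingleton.elim
      (Path.Homotopic.Quotient.trans (.mk (edgePath 2)) (.mk (edgePath 0)))
      (.mk (edgePath 1))
    have h3 : ∀ {x y z} (c : Path.Homotopic.Quotient x y) (d : Path.Homotopic.Quotient y z),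
        (c.trans d).map s = (c.map s).trans (d.map s) := by
      rintro x y z ⟨c⟩ ⟨d⟩
      exact congrArg _ (Path.map_trans c d s.continuous)
    have h2 : Φ _ _ ((Path.Homotopic.Quotient.mk (edgePath 2)).map s) +
        Φ _ _ ((Path.Homotopic.Quotient.mk (edgePath 0)).map s) =
        Φ _ _ ((Path.Homotopic.Quotient.mk (edgePath 1)).map s) := by
      refine (hΦ _ _ _ _ _).symm.trans ?_
      exact congrArg (Φ _ _) ((h3 _ _).symm.trans (congrArg (fun c => c.map s) h))
    change ∑ i : Fin 3, (-1 : ℝ) ^ (i : ℕ) * φ (s.face i) = 0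
    rw [Fin.sum_univ_three, hface, hface, hface]
    simp only [Fin.val_zero, Fin.val_one, Fin.val_two, pow_zero, pow_one, even_two, Even.neg_pow,
      one_pow, one_mul, neg_mul]
    linarith
  have hsub : Subsingleton (H1 X) := not_nontrivial_iff_subsingleton.mp hX
  obtain ⟨g, hg⟩ := (Submodule.Quotient.mk_eq_zero _).mp
    (Subsingleton.elim (Submodule.Quotient.mk ⟨φ, LinearMap.mem_ker.mpr hφ⟩ : H1 X) 0)
  replace hg : coboundary X 0 g = φ := hg
  refine ⟨fun x => g (.const _ x), fun x y c => ?_⟩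
  obtain ⟨c, rfl⟩ := Path.Homotopic.Quotient.mk_surjective c
  have h1 := congrFun hg (simplexOfPath c.toContinuousMap)
  have h0 : φ (simplexOfPath c.toContinuousMap) = Φ x y (.mk c) := by
    rw [← hΨ]
    exact congrArg Ψ (pathOfSimplex_simplexOfPath _)
  rw [h0] at h1
  rw [← h1]
  change ∑ i : Fin 2, (-1 : ℝ) ^ (i : ℕ) * g (SingularSimplex.face i _) = _
  have hv : ∀ v : stdSimplex ℝ (Fin 1), v = stdSimplex.vertex 0 := fun v => Subsingleton.elim _ _
  have hend : ∀ i : Fin 2, SingularSimplex.face i (simplexOfPath c.toContinuousMap) =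
      .const _ (simplexOfPath c.toContinuousMap (stdSimplex.vertex (i.succAbove 0))) := by
    intro i
    ext v
    rw [hv v]
    exact congrArg (simplexOfPath c.toContinuousMap)
      (stdSimplex.map_vertex (S := ℝ) i.succAbove (0 : Fin 1))
  have e0 : simplexOfPath c.toContinuousMap (stdSimplex.vertex 0) = x := by
    rw [← stdSimplexHomeomorphUnitInterval_symm_zero]
    simp [simplexOfPath]
  have e1 : simplexOfPath c.toContinuousMap (stdSimplex.vertex 1) = y := by
    rw [← stdSimplexHomeomorphUnitInterval_symm_one]
    simp [simplexOfPath]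
  rw [Fin.sum_univ_two, hend, hend]
  simp [e0, e1]
  ring

theorem symm_trans_trans {x y z : X} (p : Path.Homotopic.Quotient x y)
    (q : Path.Homotopic.Quotient y z) : p.symm.trans (p.trans q) = q := by
  rw [← Path.Homotopic.Quotient.trans_assoc, Path.Homotopic.Quotient.symm_trans,
    Path.Homotopic.Quotient.refl_trans]

theorem trans_symm_trans {x y z : X} (p : Path.Homotopic.Quotient x y)
    (q : Path.Homotopic.Quotient x z) : p.trans (p.symm.trans q) = q := by
  rw [← Path.Homotopic.Quotient.trans_assoc, Path.Homotopic.Quotient.trans_symm,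
    Path.Homotopic.Quotient.refl_trans]

/-- If `H¹(X, ℝ) = 0`, every homomorphism from the fundamental group to `ℝ` is trivial. -/
theorem hom_fundamentalGroup_eq_zero [PathConnectedSpace X] (hX : ¬ Nontrivial (H1 X)) (x₀ : X)
    (χ : FundamentalGroup X x₀ → ℝ) (hχ : ∀ p q, χ (p * q) = χ p + χ q)
    (γ : FundamentalGroup X x₀) : χ γ = 0 := by
  let P : ∀ x, Path.Homotopic.Quotient x₀ x := fun x => .mk (PathConnectedSpace.somePath x₀ x)
  let ψ : Path.Homotopic.Quotient x₀ x₀ → ℝ := χ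
  have hψ : ∀ p q, ψ (p.trans q) = ψ p + ψ q := fun p q => (hχ q p).trans (add_comm _ _)
  -- The chosen paths `P` close every path up to a loop at `x₀`, which extends `χ` additively to all
  -- paths.
  obtain ⟨h, hh⟩ := exists_primitive hX (fun x y c => ψ (((P x).trans c).trans (P y).symm)) (by
    intro x y z c d
    rw [← hψ]
    simp [symm_trans_trans])
  -- Conjugating by `P x₀` beforehand makes the closed-up loop exactly `γ`.
  have h1 := hh x₀ x₀ (((P x₀).symm.trans γ).trans (P x₀))
  simpa [trans_symm_trans] using h1

end Cohomology
end AffineManifold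

/-! ### Clopen subsets of covering spaces with finite fibres -/

section Covering

variable {E X : Type*} [TopologicalSpace E] [TopologicalSpace X] {p : E → X}

theorem IsLocalHomeomorph.locallyPathConnectedSpace [LocallyPathConnectedSpace X]
    (hp : IsLocalHomeomorph p) : LocallyPathConnectedSpace E := by
  choose e he _ using hp
  let _ : ChartedSpace X E :=
    { atlas := range e
      chartAt := e
      mem_chart_source := he
      chart_mem_atlas := mem_range_self }
  exact ChartedSpace.locallyPathConnectedSpace X E

theorem IsCoveringMap.t2Space [T2Space X] (hp : IsCoveringMap p) : T2Space E := by
  refine ⟨fun x y hxy => ?_⟩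
  by_cases h : p x = p y
  · exact hp.isSeparatedMap x y h hxy
  · obtain ⟨u, v, hu, hv, hxu, hyv, huv⟩ := t2_separation h
    exact ⟨p ⁻¹' u, p ⁻¹' v, hu.preimage hp.continuous, hv.preimage hp.continuous, hxu, hyv,
      huv.preimage p⟩

/-- Over a small compact set, a clopen subset of a covering space that meets the fibres in finite
sets is contained in a compact set. -/
theorem IsCoveringMap.exists_isCompact_of_isClopen [LocallyConnectedSpace X]
    [LocallyCompactSpace X] (hp : IsCoveringMap p) {S : Set E} (hS : IsClopen S) (x : X)
    (hfin : (S ∩ p ⁻¹' {x}).Finite) :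
    ∃ K ∈ 𝓝 x, ∃ C, IsCompact C ∧ S ∩ p ⁻¹' K ⊆ C := by
  obtain ⟨_, U, hxU, hU, _, H, hH⟩ := hp x
  -- The sheets over `U`, as sections indexed by the fibre at `x`.
  let s : p ⁻¹' {x} → U → E := fun i y => (H.symm (y, i)).1
  have hs : ∀ i, Continuous (s i) := fun i => by fun_prop
  have hps : ∀ i y, p (s i y) = y := fun i y => by
    rw [← hH, H.apply_symm_apply]
  have := hU.locallyConnectedSpace
  have := hU.locallyCompactSpace
  obtain ⟨W, ⟨hWo, hxW, hWc⟩, -⟩ :=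
    (LocallyConnectedSpace.open_connected_basis (⟨x, hxU⟩ : U)).mem_iff.mp univ_mem
  obtain ⟨K, hK, hKW, hKc⟩ := local_compact_nhds (hWo.mem_nhds hxW)
  -- Over the connected set `W` a sheet cannot leave a clopen set, so only the finitely many sheets
  -- that meet `S` over `x` matter.
  have hmem : ∀ i, ∀ y ∈ W, s i y ∈ S → s i ⟨x, hxU⟩ ∈ S := fun i y hy h =>
    hWc.isPreconnected.subset_isClopen (hS.preimage (hs i)) ⟨y, hy, h⟩ hxW
  let F : Set (p ⁻¹' {x}) := {i | s i ⟨x, hxU⟩ ∈ S}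
  have hinj : Function.Injective fun i => s i ⟨x, hxU⟩ := fun i j h => by
    simpa using H.symm.injective (Subtype.ext h)
  have hF : F.Finite := by
    refine Set.Finite.of_finite_image (f := fun i => s i ⟨x, hxU⟩) (hfin.subset ?_) hinj.injOn
    rintro _ ⟨i, hi, rfl⟩
    exact ⟨hi, hps i _⟩
  refine ⟨(↑) '' K, ?_, ⋃ i ∈ F, s i '' K, hF.isCompact_biUnion fun i _ => hKc.image (hs i), ?_⟩
  · rw [← hU.isOpenEmbedding_subtypeVal.map_nhds_eq ⟨x, hxU⟩]
    exact image_mem_map hK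
  · rintro e ⟨he, y, hyK, hy⟩
    have heU : e ∈ p ⁻¹' U := by
      rw [mem_preimage, ← hy]
      exact y.2
    have hey : (H ⟨e, heU⟩).1 = y := Subtype.ext ((hH _).trans hy.symm)
    have hse : s (H ⟨e, heU⟩).2 y = e := by
      change (H.symm (y, _)).1 = e
      rw [← hey]
      simp
    refine mem_iUnion₂.mpr ⟨(H ⟨e, heU⟩).2, hmem _ y (hKW hyK) ?_, y, hyK, hse⟩
    rwa [hse]

theorem IsCoveringMap.isCompact_of_isClopen [CompactSpace X] [LocallyConnectedSpace X]
    [LocallyCompactSpace X] (hp : IsCoveringMap p) {S : Set E} (hS : IsClopen S)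
    (hfin : ∀ x, (S ∩ p ⁻¹' {x}).Finite) : IsCompact S := by
  obtain ⟨C, hC, hSC⟩ : ∃ C, IsCompact C ∧ S ∩ p ⁻¹' univ ⊆ C := by
    refine isCompact_univ.induction_on (p := fun K => ∃ C, IsCompact C ∧ S ∩ p ⁻¹' K ⊆ C)
      ⟨∅, isCompact_empty, by simp⟩ ?_ ?_ ?_
    · rintro s t hst ⟨C, hC, htC⟩
      exact ⟨C, hC, (inter_subset_inter_right _ (preimage_mono hst)).trans htC⟩
    · rintro s t ⟨C, hC, hsC⟩ ⟨D, hD, htD⟩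
      refine ⟨C ∪ D, hC.union hD, ?_⟩
      rw [preimage_union, inter_union_distrib_left]
      exact union_subset_union hsC htD
    · intro x _
      obtain ⟨K, hK, C, hC⟩ := hp.exists_isCompact_of_isClopen hS x (hfin x)
      exact ⟨K, mem_nhdsWithin_of_mem_nhds hK, C, hC⟩
  exact hC.of_isClosed_subset hS.isClosed (by simpa using hSC)

/-- A clopen subset of a covering space of a compact space that meets the fibres in finite sets
is itself a covering space. -/
theorem IsCoveringMap.isCoveringMap_of_isClopen [T2Space X] [CompactSpace X]
    [LocallyConnectedSpace X] [LocallyCompactSpace X] (hp : IsCoveringMap p) {S : Set E}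
    (hS : IsClopen S) (hfin : ∀ x, (S ∩ p ⁻¹' {x}).Finite) :
    IsCoveringMap fun e : S => p e := by
  have := hp.t2Space
  have := isCompact_iff_compactSpace.mp (hp.isCompact_of_isClopen hS hfin)
  -- A local homeomorphism from a compact Hausdorff space to a Hausdorff space is a covering map.
  exact isLocalHomeomorph_iff_isCoveringMap.mp
    (hp.isLocalHomeomorph.comp hS.isOpen.isOpenEmbedding_subtypeVal.isLocalHomeomorph)

/-- A path component of a locally path connected covering space maps onto a path connected base. -/
theorem IsCoveringMap.exists_mem_pathComponent [PathConnectedSpace X] (hp : IsCoveringMap p)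
    (e : E) (x : X) : ∃ e' ∈ pathComponent e, p e' = x := by
  let c := PathConnectedSpace.somePath (p e) x
  refine ⟨hp.liftPath c e c.source 1, ⟨⟨hp.liftPath c e c.source, ?_, rfl⟩⟩, ?_⟩
  · exact hp.liftPath_zero _ _ _
  · exact (congrFun (hp.liftPath_lifts c e c.source) 1).trans c.target

/-- Monodromy is natural with respect to continuous maps of covering spaces. -/
theorem IsCoveringMap.monodromy_comp {E' : Type*} [TopologicalSpace E'] {p' : E' → X}
    (hp : IsCoveringMap p) (hp' : IsCoveringMap p') {q : E → E'} (hq : Continuous q)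
    (hqp : ∀ e, p' (q e) = p e) {x y : X} (c : Path.Homotopic.Quotient x y) (e : p ⁻¹' {x}) :
    (hp'.monodromy c ⟨q e, (hqp e).trans e.2⟩).1 = q (hp.monodromy c e).1 := by
  obtain ⟨c⟩ := c
  have h0 : c 0 = p e := c.source.trans e.2.symm
  have h1 : c 0 = p' (q e) := h0.trans (hqp e).symm
  have key : q ∘ hp.liftPath c e h0 = hp'.liftPath c (q e) h1 := by
    refine (hp'.eq_liftPath_iff h1).2 ⟨hq.comp (ContinuousMap.continuous _), ?_, ?_⟩
    · funext t
      exact (hqp _).trans (congrFun (hp.liftPath_lifts c e h0) t)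
    · simp only [Function.comp_apply, hp.liftPath_zero]
  exact (congrFun key 1).symm

end Covering

namespace AffineManifold

/-! ### The flat cotangent bundle and increments of affine functions -/

section Development

variable {n : ℕ}

/-- The dual space of `ℝⁿ`, with the discrete topology. -/
def Covector (n : ℕ) : Type := Model n →ₗ[ℝ] ℝ

instance : TopologicalSpace (Covector n) := ⊥

instance : DiscreteTopology (Covector n) := ⟨rfl⟩

/-- The linear form underlying a covector. -/
def Covector.toLinearMap (l : Covector n) : Model n →ₗ[ℝ] ℝ := l

/-- The pullback of a linear form by the linear part of an affine transformation. -/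
def Covector.pull (l : Covector n) (A : Aff n) : Covector n :=
  LinearMap.comp l.toLinearMap (A.linear : Model n →ₗ[ℝ] Model n)

theorem Covector.pull_mul (l : Covector n) (A B : Aff n) :
    l.pull (A * B) = (l.pull A).pull B := rfl

theorem Covector.pull_one (l : Covector n) : l.pull 1 = l := rfl

variable (n) (M : Type u) [TopologicalSpace M] [ChartedSpace (Model n) M]
  [HasGroupoid M (affineGroupoid n)]

/-- The flat cotangent bundle of an affine manifold, with discrete fibres. The pair `(x, l)` stands
for the covector at `x` that is the pullback of `l` by `chartAt x`. -/
def cotangentCore : FiberBundleCore (atlas (Model n) M) M (Covector n) where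
  baseSet := (germBundle n M).baseSet
  isOpen_baseSet := (germBundle n M).isOpen_baseSet
  indexAt := (germBundle n M).indexAt
  mem_baseSet_at := (germBundle n M).mem_baseSet_at
  coordChange e e' x l := l.pull ((germBundle n M).coordChange e e' x 1)
  coordChange_self e x hx l := by
    rw [(germBundle n M).coordChange_self e x hx, Covector.pull_one]
  continuousOn_coordChange e e' := by
    have h1 : ContinuousOn (fun x : M => (germBundle n M).coordChange e e' x 1)
        ((germBundle n M).baseSet e ∩ (germBundle n M).baseSet e') :=
      ((germBundle n M).continuousOn_coordChange e e').comp (f := fun x => (x, 1))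
        (by fun_prop) fun x hx => ⟨hx, mem_univ _⟩
    have h2 : Continuous fun q : Covector n × Aff n => q.1.pull q.2 :=
      continuous_of_discreteTopology
    exact h2.comp_continuousOn
      (continuousOn_snd.prodMk (h1.comp continuousOn_fst fun p hp => hp.1))
  coordChange_comp e e' e'' x hx l := by
    have h := (germBundle n M).coordChange_comp e e' e'' x hx 1
    rw [← h, ← Covector.pull_mul]
    congr 1

theorem isCoveringMap_cotangent : IsCoveringMap (cotangentCore n M).proj :=
  FiberBundle.isCoveringMap

variable {n M}

/-- The differential of `f` composed with a germ of affine coordinate system. -/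
def AffineGerm.pull (f : Covector n) (p : AffineGerm n M) : (cotangentCore n M).TotalSpace :=
  ⟨p.1, f.pull p.toAff⟩

theorem AffineGerm.pull_continuous (f : Covector n) :
    Continuous (AffineGerm.pull (M := M) f) := by
  rw [continuous_iff_continuousAt]
  intro p
  let Z := germBundle n M
  let Z' := cotangentCore n M
  let e := Z.localTriv (Z.indexAt p.1)
  let e' := Z'.localTriv (Z'.indexAt p.1)
  have hp : p.1 ∈ Z.baseSet (Z.indexAt p.1) := Z.mem_baseSet_at p.1
  refine e'.continuousAt_of_comp_left (f := AffineGerm.pull f) ?_ hp ?_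
  · exact (Z.continuous_proj).continuousAt
  · have h : e' ∘ AffineGerm.pull f = (fun q : M × Aff n => (q.1, f.pull q.2)) ∘ e := by
      funext q
      refine Prod.ext rfl ?_
      change (f.pull q.toAff).pull (1 * _) = f.pull (q.toAff * _)
      rw [one_mul]
      rfl
    rw [h]
    refine ContinuousAt.comp ?_ (e.continuousAt ?_)
    · exact (continuous_fst.prodMk ((continuous_of_discreteTopology
        (f := fun A : Aff n => f.pull A)).comp continuous_snd)).continuousAt
    · exact (e.mem_source).2 hp

theorem AffineGerm.pull_isLocalHomeomorph (f : Covector n) :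
    IsLocalHomeomorph (AffineGerm.pull (M := M) f) :=
  IsLocalHomeomorph.of_comp (g := (cotangentCore n M).proj)
    (isCoveringMap_germ n M).isLocalHomeomorph
    (isCoveringMap_cotangent n M).isLocalHomeomorph (AffineGerm.pull_continuous f)

/-- Near a germ, the value of a germ is given by a single affine coordinate system. -/
theorem AffineGerm.eval_eventuallyEq (p : AffineGerm n M) :
    AffineGerm.eval =ᶠ[𝓝 p] fun q => p.toAff (chartAt (Model n) p.1 q.1) := by
  let Z := germBundle n M
  let e := Z.localTriv (Z.indexAt p.1)
  have hp : p.1 ∈ Z.baseSet (Z.indexAt p.1) := Z.mem_baseSet_at p.1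
  have h1 : ∀ᶠ q in 𝓝 p, (e q).2 = (e p).2 := by
    have hc : ContinuousAt (fun q => (e q).2) p :=
      continuousAt_snd.comp (e.continuousAt ((e.mem_source).2 hp))
    refine hc.eventually (p := fun A => A = (e p).2) ?_
    rw [nhds_discrete]
    exact rfl
  have h2 : ∀ᶠ q in 𝓝 p, Z.proj q ∈ Z.baseSet (Z.indexAt p.1) :=
    Z.continuous_proj.continuousAt.eventually ((Z.isOpen_baseSet _).mem_nhds hp)
  have h3 : (e p).2 = p.toAff := Z.coordChange_self _ _ hp _
  filter_upwards [h1, h2] with q hq hqs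
  rw [h3] at hq
  obtain ⟨T, hT⟩ := exists_isTransition (n := n) (chart_mem_atlas (Model n) q.1)
    (chart_mem_atlas (Model n) p.1) ⟨mem_chart_source _ q.1, hqs⟩
  change q.toAff * (transition (chartAt (Model n) q.1) (chartAt (Model n) p.1) q.1)⁻¹ = _ at hq
  rw [transition_eq (mem_chart_source _ q.1) hT, mul_inv_eq_iff_eq_mul] at hq
  rw [hT.self_of_nhds, AffineGerm.eval, hq]
  rfl

/-- Near `p`, evaluation is the projection to `M`, then a chart, then an affine isomorphism, each a
local homeomorphism. This yields both continuity and openness of the developing map. -/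
theorem AffineGerm.map_eval_nhds (p : AffineGerm n M) :
    map AffineGerm.eval (𝓝 p) = 𝓝 p.eval := by
  rw [map_congr p.eval_eventuallyEq]
  have h1 : map (germBundle n M).proj (𝓝 p) = 𝓝 p.1 :=
    (isCoveringMap_germ n M).isLocalHomeomorph.map_nhds_eq p
  have h2 := (chartAt (Model n) p.1).map_nhds_eq (mem_chart_source (Model n) p.1)
  have h3 : map p.toAff (𝓝 (chartAt (Model n) p.1 p.1)) = 𝓝 p.eval :=
    (AffineEquiv.toContinuousAffineEquiv p.toAff).toHomeomorph.map_nhds_eq _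
  rw [← h3, ← h2, ← h1, map_map, map_map]
  rfl

theorem AffineGerm.eval_continuous : Continuous (AffineGerm.eval (n := n) (M := M)) :=
  continuous_iff_continuousAt.mpr fun p => p.map_eval_nhds.le

theorem AffineGerm.eval_isOpenMap : IsOpenMap (AffineGerm.eval (n := n) (M := M)) :=
  isOpenMap_iff_nhds_le.mpr fun p => p.map_eval_nhds.ge

/-- The increment of the function `f` of an affine coordinate system continued along a path. -/
def increment (f : Covector n) {x y : M} (c : Path.Homotopic.Quotient x y)
    (a : (germBundle n M).proj ⁻¹' {x}) : ℝ :=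
  f.toLinearMap
    (AffineGerm.eval ((isCoveringMap_germ n M).monodromy c a).1 - AffineGerm.eval a.1)

theorem increment_trans (f : Covector n) {x y z : M} (c : Path.Homotopic.Quotient x y)
    (d : Path.Homotopic.Quotient y z) (a : (germBundle n M).proj ⁻¹' {x}) :
    increment f (c.trans d) a =
      increment f c a + increment f d ((isCoveringMap_germ n M).monodromy c a) := by
  rw [increment, increment, increment, IsCoveringMap.monodromy_trans_apply, ← map_add]
  congr 1
  abel

/-- The increment depends only on the differential of the function at the starting point. -/
theorem increment_eq_of_pull_eq (f : Covector n) {x y : M} (c : Path.Homotopic.Quotient x y)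
    {a b : (germBundle n M).proj ⁻¹' {x}} (h : AffineGerm.pull f a.1 = AffineGerm.pull f b.1) :
    increment f c a = increment f c b := by
  obtain ⟨⟨x, A⟩, rfl⟩ := a
  obtain ⟨⟨x', B⟩, hx⟩ := b
  obtain rfl : x' = x := hx
  change Aff n at A B
  have hAB : f.pull A = f.pull B := 
    Bundle.TotalSpace.mk_injective (E := (cotangentCore n M).Fiber) x' h
  -- The two germs differ by the left action of `B * A⁻¹`, whose linear part preserves `f`.
  -- Continuation commutes with this action, so `f` sees the same increment.
  have hT : f.pull (B * A⁻¹) = f := by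
    rw [Covector.pull_mul, ← hAB, ← Covector.pull_mul, mul_inv_cancel, Covector.pull_one]
  have hact : AffineGerm.act (B * A⁻¹) (AffineGerm.mk x' A) = AffineGerm.mk x' B :=
    congrArg (AffineGerm.mk x') (inv_mul_cancel_right (G := Aff n) B A)
  have hmono := monodromy_act c (B * A⁻¹) (p := ⟨AffineGerm.mk x' A, rfl⟩)
  have hb : (⟨AffineGerm.act (B * A⁻¹) (AffineGerm.mk x' A), rfl⟩ :
      (germBundle n M).proj ⁻¹' {x'}) = ⟨AffineGerm.mk x' B, rfl⟩ := Subtype.ext hact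
  have hval : ∀ p q : AffineGerm n M,
      f.toLinearMap ((AffineGerm.act (B * A⁻¹) p).eval -
        (AffineGerm.act (B * A⁻¹) q).eval) = f.toLinearMap (p.eval - q.eval) := by
    intro p q
    have h1 : (AffineGerm.act (B * A⁻¹) p).eval - (AffineGerm.act (B * A⁻¹) q).eval =
        (B * A⁻¹).linear (p.eval - q.eval) :=
      ((B * A⁻¹ : Aff n).toAffineMap.linearMap_vsub p.eval q.eval).symm
    rw [h1]
    exact LinearMap.congr_fun hT _
  have h2 := hval ((isCoveringMap_germ n M).monodromy c ⟨AffineGerm.mk x' A, rfl⟩).1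
    (AffineGerm.mk x' A)
  rw [← hmono, hb, hact] at h2
  exact h2.symm

end Development
end AffineManifold

namespace AffineManifold

/-! ### The space of continuations of a linear form -/

section LinearForm

variable {n : ℕ} {M : Type u} [TopologicalSpace M] [ChartedSpace (Model n) M]
  [HasGroupoid M (affineGroupoid n)]

/-- `AffineGerm.pull f` is a map of coverings, hence commutes with monodromy; and lifting the
projection of a path from its own starting point returns that path. -/
theorem AffineGerm.pull_monodromy (f : Covector n) {e e' : (cotangentCore n M).TotalSpace}
    (c : Path.Homotopic.Quotient e e') (a : (germBundle n M).proj ⁻¹' {e.1})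
    (ha : AffineGerm.pull f a.1 = e) :
    AffineGerm.pull f ((isCoveringMap_germ n M).monodromy
      (c.map ⟨_, (isCoveringMap_cotangent n M).continuous⟩) a).1 = e' := by
  have h1 := IsCoveringMap.monodromy_comp (isCoveringMap_germ n M) (isCoveringMap_cotangent n M)
    (AffineGerm.pull_continuous f) (fun _ => rfl)
    (c.map ⟨_, (isCoveringMap_cotangent n M).continuous⟩) a
  have h2 := (isCoveringMap_cotangent n M).monodromy_map c
  have h3 : (⟨AffineGerm.pull f a.1, a.2⟩ : (cotangentCore n M).proj ⁻¹' {e.1}) = ⟨e, rfl⟩ :=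
    Subtype.ext ha
  rw [← h1]
  erw [h3, h2]

/-- The covectors obtained by continuation of the linear form `f` in the chart at `x₀`. -/
abbrev Continued (f : Covector n) (x₀ : M) : Set (cotangentCore n M).TotalSpace :=
  pathComponent (AffineGerm.pull f (AffineGerm.mk x₀ 1))

theorem exists_pull_eq_of_mem_continued (f : Covector n) (x₀ : M)
    {e : (cotangentCore n M).TotalSpace} (he : e ∈ Continued f x₀) :
    ∃ a ∈ pathComponent (AffineGerm.mk x₀ 1), AffineGerm.pull f a = e := by
  obtain ⟨c⟩ := he
  let d : Path x₀ e.1 := c.map (isCoveringMap_cotangent n M).continuous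
  let a := (isCoveringMap_germ n M).liftPath d (AffineGerm.mk x₀ 1) d.source
  refine ⟨a 1, ⟨⟨a, (isCoveringMap_germ n M).liftPath_zero _ _ _, rfl⟩⟩, ?_⟩
  exact AffineGerm.pull_monodromy f (.mk c) ⟨AffineGerm.mk x₀ 1, rfl⟩ rfl

theorem pull_mem_continued (f : Covector n) (x₀ : M) {a : AffineGerm n M}
    (ha : a ∈ pathComponent (AffineGerm.mk x₀ 1)) : AffineGerm.pull f a ∈ Continued f x₀ :=
  ha.map (AffineGerm.pull_continuous f)

theorem exists_continuation_eq (x₀ : M) {a : AffineGerm n M}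
    (ha : a ∈ pathComponent (AffineGerm.mk x₀ 1)) {x : M} (hx : a.1 = x) :
    ∃ c : Path.Homotopic.Quotient x₀ x, continuation x₀ c = a := by
  subst hx
  obtain ⟨c⟩ := ha
  exact ⟨_, congrArg Subtype.val ((isCoveringMap_germ n M).monodromy_map (.mk c))⟩

/-- Two continuations to `x` along different paths differ by the holonomy of a loop at `x₀`, so the
fibre is controlled by the holonomy orbit of `f`. -/
theorem finite_continued_inter_fiber (f : Covector n) (x₀ : M)
    (hf : (range fun γ : FundamentalGroup M x₀ => f.pull (holonomy x₀ γ)).Finite) (x : M) :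
    (Continued f x₀ ∩ (cotangentCore n M).proj ⁻¹' {x}).Finite := by
  rcases (Continued f x₀ ∩ (cotangentCore n M).proj ⁻¹' {x}).eq_empty_or_nonempty with h | h
  · rw [h]
    exact finite_empty
  obtain ⟨e₀, he₀, hx₀⟩ := h
  obtain ⟨a₀, ha₀, rfl⟩ := exists_pull_eq_of_mem_continued f x₀ he₀
  obtain rfl : a₀.1 = x := hx₀
  obtain ⟨c₀, hc₀⟩ := exists_continuation_eq x₀ ha₀ rfl
  refine (hf.image fun l => AffineGerm.pull l a₀).subset ?_
  rintro e ⟨he, hx⟩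
  obtain ⟨a, ha, rfl⟩ := exists_pull_eq_of_mem_continued f x₀ he
  obtain ⟨c, hc⟩ := exists_continuation_eq x₀ ha hx
  have hg : ∀ (y : M) (c : Path.Homotopic.Quotient x₀ y) (d : Path.Homotopic.Quotient x₀ y),
      ∃ γ : FundamentalGroup M x₀, continuation (n := n) x₀ c =
        AffineGerm.act (holonomy x₀ γ) (continuation x₀ d) := by
    intro y c d
    -- The inverse compensates for the one in the definition of `holonomy`.
    let γ : FundamentalGroup M x₀ := (FundamentalGroup.fromPath (c.trans d.symm))⁻¹
    refine ⟨γ, ?_⟩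
    have h1 := continuation_trans (n := n) x₀ (FundamentalGroup.toPath γ⁻¹) d
    have h2 : (FundamentalGroup.toPath γ⁻¹).trans d = c := by
      rw [inv_inv]
      change (c.trans d.symm).trans d = c
      simp
    rw [h2] at h1
    exact h1
  obtain ⟨γ, hγ⟩ := hg _ c c₀
  refine ⟨_, ⟨γ, rfl⟩, ?_⟩
  rw [← hc, hγ, hc₀]
  rfl

theorem continued_isClopen (f : Covector n) (x₀ : M) : IsClopen (Continued f x₀) := by
  have := ChartedSpace.locallyPathConnectedSpace (Model n) M
  have := IsLocalHomeomorph.locallyPathConnectedSpace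
    (isCoveringMap_cotangent n M).isLocalHomeomorph
  exact IsClopen.pathComponent _

/-- Continuation of a nonzero linear form defines a nonzero cohomology class on the space of all
its continuations if this space is compact. -/
theorem nontrivial_H1_continued (f : Covector n) (hf : Function.Surjective f.toLinearMap) (x₀ : M)
    (hc : IsCompact (Continued f x₀)) :
    Nontrivial (H1 (Continued f x₀)) := by
  by_contra hH
  have hpull : ∀ e : Continued f x₀, ∃ a : AffineGerm n M, AffineGerm.pull f a = e := fun e =>
    (exists_pull_eq_of_mem_continued f x₀ e.2).imp fun _ h => h.2
  choose a ha using hpull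
  have hae : ∀ e : Continued f x₀, (germBundle n M).proj (a e) = e.1.1 := fun e =>
    congrArg (cotangentCore n M).proj (ha e)
  let ι : C(Continued f x₀, (cotangentCore n M).TotalSpace) := ⟨_, continuous_subtype_val⟩
  let π : C((cotangentCore n M).TotalSpace, M) := ⟨_, (isCoveringMap_cotangent n M).continuous⟩
  -- The germ `a e` is an arbitrary choice; additivity holds because the increment depends only on
  -- its covector `e`.
  obtain ⟨h, hh⟩ := exists_primitive hH
    (fun e e' c => increment f ((c.map ι).map π) ⟨a e, hae e⟩) (by
      intro x y z c d
      have h1 : ((c.trans d).map ι).map π = ((c.map ι).map π).trans ((d.map ι).map π) := by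
        obtain ⟨c⟩ := c
        obtain ⟨d⟩ := d
        refine congrArg Path.Homotopic.Quotient.mk ?_
        rw [← Path.map_trans, ← Path.map_trans]
      rw [h1, increment_trans]
      congr 1
      exact increment_eq_of_pull_eq f _
        ((AffineGerm.pull_monodromy f (c.map ι) ⟨a x, hae x⟩ (ha x)).trans (ha y).symm))
  let G : Set (AffineGerm n M) := pathComponent (AffineGerm.mk x₀ 1)
  let q : G → Continued f x₀ := fun b => ⟨AffineGerm.pull f b.1, pull_mem_continued f x₀ b.2⟩
  have hqc : Continuous q :=
    ((AffineGerm.pull_continuous f).comp continuous_subtype_val).subtype_mk _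
  let f' := f.toLinearMap
  let g₀ : G := ⟨AffineGerm.mk x₀ 1, mem_pathComponent_self _⟩
  -- On germs, the primitive is `f` of the developed point up to a constant: both change by the same
  -- increment along a path from the base germ.
  have hval : ∀ b : G, h (q b) =
      f' (AffineGerm.eval b.1) + (h (q g₀) - f' (AffineGerm.eval g₀.1)) := by
    rintro ⟨b, ⟨c⟩⟩
    have : PathConnectedSpace unitInterval :=
      isPathConnected_iff_pathConnectedSpace.mp
        ((convex_Icc (0 : ℝ) 1).isPathConnected (nonempty_Icc.mpr zero_le_one))
    have hmem : ∀ t, c t ∈ G := fun t =>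
      ((isPathConnected_range c.continuous).joinedIn _ ⟨0, c.source⟩ _ ⟨t, rfl⟩).joined
    let c' : Path g₀ ⟨b, ⟨c⟩⟩ :=
      { toFun := fun t => ⟨c t, hmem t⟩
        continuous_toFun := c.continuous.subtype_mk _
        source' := Subtype.ext c.source
        target' := Subtype.ext c.target }
    have h1 := hh _ _ (.mk (c'.map hqc))
    have h2 := increment_eq_of_pull_eq f
      (((Path.Homotopic.Quotient.mk (c'.map hqc)).map ι).map π)
      (a := ⟨a (q g₀), hae (q g₀)⟩) (b := ⟨AffineGerm.mk x₀ 1, rfl⟩) (ha (q g₀))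
    have h3 := congrArg Subtype.val ((isCoveringMap_germ n M).monodromy_map (.mk c))
    have h4 : increment f (((Path.Homotopic.Quotient.mk (c'.map hqc)).map ι).map π)
        ⟨AffineGerm.mk x₀ 1, rfl⟩ = f' (AffineGerm.eval b - AffineGerm.eval g₀.1) :=
      congrArg (fun p => f' (AffineGerm.eval p - AffineGerm.eval g₀.1)) h3
    rw [h2, h4, map_sub] at h1
    linarith
  have := ChartedSpace.locallyPathConnectedSpace (Model n) M
  have := IsLocalHomeomorph.locallyPathConnectedSpace (isCoveringMap_germ n M).isLocalHomeomorph
  have hG : IsOpen G := IsOpen.pathComponent _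
  have hqo : IsOpenMap q :=
    (continued_isClopen f x₀).isOpen.isOpenEmbedding_subtypeVal.isOpenMap_iff.mpr
      ((AffineGerm.pull_isLocalHomeomorph f).isOpenMap.comp hG.isOpenMap_subtype_val)
  have hqs : Function.Surjective q := by
    rintro ⟨e, he⟩
    obtain ⟨b, hb, rfl⟩ := exists_pull_eq_of_mem_continued f x₀ he
    exact ⟨⟨b, hb⟩, rfl⟩
  have hφ : h ∘ q = (· + (h (q g₀) - f' (AffineGerm.eval g₀.1))) ∘ f' ∘ AffineGerm.eval ∘
      ((↑) : G → AffineGerm n M) := funext hval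
  have hf'c : Continuous f' := f'.continuous_of_finiteDimensional
  -- Continuity descends from germs because `q` is an open surjection.
  have hhc : Continuous h := by
    rw [(IsOpenQuotientMap.mk hqs hqc hqo).isQuotientMap.continuous_iff, hφ]
    exact (continuous_add_const _).comp
      (hf'c.comp (AffineGerm.eval_continuous.comp continuous_subtype_val))
  have hho : IsOpenMap (h ∘ q) := by
    rw [hφ]
    exact (isOpenMap_add_right _).comp ((f'.isOpenMap_of_finiteDimensional hf).comp
      (AffineGerm.eval_isOpenMap.comp hG.isOpenMap_subtype_val))
  have hrange : range (h ∘ q) = range h := hqs.range_comp h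
  have := isCompact_iff_compactSpace.mp hc
  have hcomp : IsCompact (range h) := isCompact_range hhc
  have hopen : IsOpen (range h) := hrange ▸ hho.isOpen_range
  have huniv := IsClopen.eq_univ ⟨hcomp.isClosed, hopen⟩ ⟨_, mem_range_self (q g₀)⟩
  exact noncompact_univ ℝ (huniv ▸ hcomp)

/-- The linear form defining an invariant hyperplane is multiplied by a character. -/
theorem LinearFoliation.exists_character {x₀ : M} (F : LinearFoliation n M x₀)
    (hF : F.codim = 1) :
    ∃ (f : Model n →ₗ[ℝ] ℝ) (χ : FundamentalGroup M x₀ →* ℝ), Function.Surjective f ∧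
      ∀ γ w, f (linearHolonomy x₀ γ w) = χ γ * f w := by
  let Q : (Model n ⧸ F.direction) ≃ₗ[ℝ] ℝ :=
    LinearEquiv.ofFinrankEq _ _ (hF.trans (Module.finrank_self ℝ).symm)
  let f : Model n →ₗ[ℝ] ℝ := Q.toLinearMap ∘ₗ F.direction.mkQ
  have hsurj : Function.Surjective f := Q.surjective.comp F.direction.mkQ_surjective
  have hker : ∀ w, f w = 0 ↔ w ∈ F.direction := fun w => by simp [f]
  -- Since `v` spans a complement of the hyperplane, the factor of `γ` can be read off as `f
  -- (linearHolonomy x₀ γ v)`.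
  obtain ⟨v, hv⟩ := hsurj 1
  have key : ∀ (γ : FundamentalGroup M x₀) w,
      f (linearHolonomy x₀ γ w) = f (linearHolonomy x₀ γ v) * f w := by
    intro γ w
    have h1 : w - f w • v ∈ F.direction := by
      rw [← hker]
      simp [hv]
    have h2 : linearHolonomy x₀ γ (w - f w • v) ∈ F.direction := by
      rw [← F.map_linearHolonomy γ]
      exact Submodule.mem_map_of_mem h1
    rw [← hker] at h2
    simp only [map_sub, map_smul, smul_eq_mul] at h2
    linarith
  refine ⟨f, ⟨⟨fun γ => f (linearHolonomy x₀ γ v), ?_⟩, fun p q => ?_⟩, hsurj, key⟩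
  · exact (congrArg (fun T : Model n ≃ₗ[ℝ] Model n => f (T v)) (map_one (linearHolonomy x₀))).trans
      hv
  · exact (congrArg (fun T : Model n ≃ₗ[ℝ] Model n => f (T v))
      (map_mul (linearHolonomy x₀) p q)).trans (key p _)

end LinearForm
end AffineManifold

end

/-! ### The finite cover -/

theorem corollary4p3 (n : ℕ) (M : Type u) [TopologicalSpace M] [T2Space M] [CompactSpace M]
    [ConnectedSpace M] [ChartedSpace (AffineManifold.Model n) M]
    [HasGroupoid M (AffineManifold.affineGroupoid n)] (x₀ : M)
    (F : AffineManifold.LinearFoliation n M x₀) (hF : F.codim = 1) :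
    ∃ (M' : Type u) (_ : TopologicalSpace M') (p : M' → M),
      ConnectedSpace M' ∧ IsCoveringMap p ∧ Function.Surjective p ∧
        (∀ x : M, (p ⁻¹' {x}).Finite) ∧ Nontrivial (AffineManifold.H1 M') := by
  have := ChartedSpace.locallyPathConnectedSpace (AffineManifold.Model n) M
  have := ChartedSpace.locallyCompactSpace (AffineManifold.Model n) M
  have : PathConnectedSpace M := pathConnectedSpace_iff_connectedSpace.mpr inferInstance
  by_cases hM : Nontrivial (AffineManifold.H1 M)
  · exact ⟨M, inferInstance, id, inferInstance,
      isLocalHomeomorph_iff_isCoveringMap.mp (Homeomorph.refl M).isLocalHomeomorph,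
      Function.surjective_id, fun x => finite_singleton x, hM⟩
  obtain ⟨f, χ, hf, hχ⟩ := F.exists_character hF
  have hχ0 : ∀ γ, χ γ ≠ 0 := fun γ => ((Group.isUnit γ).map χ).ne_zero
  have hχ1 : ∀ γ, χ γ = 1 ∨ χ γ = -1 := by
    intro γ
    -- `Real.log` is the logarithm of the absolute value, so its vanishing leaves the sign of `χ γ`
    -- free.
    have h := AffineManifold.hom_fundamentalGroup_eq_zero hM x₀ (fun γ => Real.log (χ γ))
      (fun p q => by rw [map_mul, Real.log_mul (hχ0 p) (hχ0 q)]) γ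
    rcases Real.log_eq_zero.mp h with h | h | h
    · exact absurd h (hχ0 γ)
    · exact .inl h
    · exact .inr h
  have horb : (range fun γ : FundamentalGroup M x₀ =>
      AffineManifold.Covector.pull f (AffineManifold.holonomy x₀ γ)).Finite := by
    refine (Set.toFinite ({f, -f} : Set (AffineManifold.Model n →ₗ[ℝ] ℝ))).subset ?_
    rintro _ ⟨γ, rfl⟩
    rcases hχ1 γ with h | h
    · refine .inl (LinearMap.ext fun w => (hχ γ w).trans ?_)
      rw [h, one_mul]
    · refine .inr (LinearMap.ext fun w => (hχ γ w).trans ?_)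
      rw [h, neg_one_mul]
      rfl
  have hS := AffineManifold.continued_isClopen (M := M) f x₀
  have hfin := AffineManifold.finite_continued_inter_fiber f x₀ horb
  have hcov := AffineManifold.isCoveringMap_cotangent n M
  refine ⟨AffineManifold.Continued f x₀, inferInstance, fun e => e.1.1,
    isConnected_iff_connectedSpace.mp isPathConnected_pathComponent.isConnected,
    hcov.isCoveringMap_of_isClopen hS hfin, fun x => ?_, fun x => ?_,
    AffineManifold.nontrivial_H1_continued f hf x₀ (hcov.isCompact_of_isClopen hS hfin)⟩
  · obtain ⟨e, he, hx⟩ := hcov.exists_mem_pathComponent _ x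
    exact ⟨⟨e, he⟩, hx⟩
  · refine Set.Finite.of_finite_image ((hfin x).subset ?_) Subtype.val_injective.injOn
    rintro _ ⟨e, he, rfl⟩
    exact ⟨e.2, he⟩
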